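/- For $0<\alpha<1/2$ let $C_\alpha\subset[0,1]$ be the middle-$(1-2\alpha)$ Cantor set: start from $[0,1]$ and, at every step, replace each interval $[x,x+\ell]$ by the two intervals $[x,x+\alpha\ell]$ and $[x+(1-\alpha)\ell,x+\ell]$; $C_\alpha$ is the intersection of all steps. Let $\tau(K)$ denote the Newhouse thickness of a compact set $K\subset\mathbb{R}$, i.e. the infimum, over all bounded gaps $U$ of $K$ (bounded connected components of $\mathbb{R}\setminus K$) and all endpoints $u$ of $U$, of $|B|/|U|$, where the bridge $B$ is the maximal interval having $u$ as an endpoint and containing no point of any gap of $K$ of length at least $|U|$. Let $0<\alpha,\beta<1/2$ and assume $\tau(C_\alpha)\,\tau(C_\beta)<1$. (i) If $\log\alpha/\log\beta$ is irrational, then $C_\alpha+C_\beta\neq[0,2]$. (ii) If $\log\alpha/\log\beta$ is rational, then there are coprime positive integers $m_0,n_0$ and a real number $\gamma$ (necessarily $\gamma>1$) with $\alpha=\gamma^{-n_0}$ and $\beta=\gamma^{-m_0}$, and for any such $m_0,n_0,\gamma$ we have $C_\alpha+C_\beta=[0,2]$ if and only if $$\Big[\log_\gamma\frac{1-2\beta}{\alpha},\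 1-\log_\gamma\frac{1-2\alpha}{\beta}\Big]\cap\{-m_0+1,\dots,-1,0,1,\dots,n_0\}\neq\emptyset,$$ where $[x,y]$ is understood to be empty if $x>y$. -/

import Mathlib

open Set
open scoped Pointwise ENNReal

/-- The `n`-th step of the construction of the middle Cantor set with contraction ratio `α`:
it starts from `[0, 1]` and replaces every interval `[x, x + ℓ]` by the two intervals
`[x, x + α ℓ]` and `[x + (1 - α) ℓ, x + ℓ]`. -/
def preMiddleCantor (α : ℝ) : ℕ → Set ℝ
  | 0 => Set.Icc 0 1
  | n + 1 => (fun x => α * x) '' preMiddleCantor α n ∪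
      (fun x => (1 - α) + α * x) '' preMiddleCantor α n

/-- The middle-`(1 - 2α)` Cantor set `C_α` in `[0, 1]` (for `0 < α < 1/2`), i.e. the maximal
invariant set of the expanding map `x ↦ x / α` on `[0, α]`, `x ↦ (x - (1 - α)) / α` on
`[1 - α, 1]`. -/
def middleCantor (α : ℝ) : Set ℝ := ⋂ n, preMiddleCantor α n

/-- `(a, b)` is a bounded gap of the closed set `K`: a bounded connected component of the
complement of `K`. -/
def IsBoundedGap (K : Set ℝ) (a b : ℝ) : Prop :=
  a < b ∧ a ∈ K ∧ b ∈ K ∧ Disjoint (Set.Ioo a b) K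

/-- `[c, d]`, with endpoints in `K`, meets no gap of `K` of length at least `ℓ`.
(A gap of `K` which meets such an interval is bounded and contained in it.) -/
def AvoidsGaps (K : Set ℝ) (ℓ c d : ℝ) : Prop :=
  c ≤ d ∧ c ∈ K ∧ d ∈ K ∧
    ∀ a b : ℝ, IsBoundedGap K a b → c ≤ a → b ≤ d → b - a < ℓ

/-- The length of the bridge of `K` at the left endpoint `a` of the gap `(a, b)`: the maximal
interval `[c, a]` which meets no gap of `K` of length at least `b - a`. -/
noncomputable def leftBridge (K : Set ℝ) (a b : ℝ) : ℝ≥0∞ :=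
  ⨆ (c : ℝ) (_ : AvoidsGaps K (b - a) c a), ENNReal.ofReal (a - c)

/-- The length of the bridge of `K` at the right endpoint `b` of the gap `(a, b)`: the maximal
interval `[b, d]` which meets no gap of `K` of length at least `b - a`. -/
noncomputable def rightBridge (K : Set ℝ) (a b : ℝ) : ℝ≥0∞ :=
  ⨆ (d : ℝ) (_ : AvoidsGaps K (b - a) b d), ENNReal.ofReal (d - b)

/-- Newhouse's thickness `τ(K)` of a compact set `K`: the infimum, over all bounded gaps and both
of their endpoints, of the length of the bridge divided by the length of the gap. -/
noncomputable def thickness (K : Set ℝ) : ℝ≥0∞ :=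
  ⨅ (a : ℝ) (b : ℝ) (_ : IsBoundedGap K a b),
    min (leftBridge K a b) (rightBridge K a b) / ENNReal.ofReal (b - a)

/-!
Write `A = (1 - 2β) / α` and `B = (1 - 2α) / β`. Every bounded gap of `C_α` is an affine copy, by a
composition of the two branches, of the central gap `(α, 1 - α)`, whose bridges `[0, α]` and
`[1 - α, 1]` contain only shorter gaps. Hence `τ(C_α) ≥ α / (1 - 2α)`, and the hypothesis on the
thicknesses gives `A * B > 1` (`ratio_of_thickness_mul_lt_one`).

*Obstruction* (`sum_ne_of_ratio_mem`). Near `0` the sum `C_α + C_β` agrees with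
`α ^ n C_α + β ^ m C_β = α ^ n (C_α + s C_β)`, where `s = β ^ m / α ^ n`. If `s < 1 - 2α`, then
`C_α + s C_β` misses the points between `α + s` and `1 - α`, and the point just to the right of
`α + s` is not covered by a larger piece of `C_β` as long as `s > α β / (1 - 2β)`. Since `A * B > 1`,
the interval `(α β / (1 - 2β), 1 - 2α)` is nonempty. When `log α / log β` is irrational the ratios
`β ^ m / α ^ n` are dense in `(0, ∞)`, so that one of them lies there. When `α = γ ^ (-n₀)` and
`β = γ ^ (-m₀)`, they are all the powers of `γ`, and a full sum forces an integer `k` with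
`A ≤ γ ^ k` and `B ≤ γ ^ (1 - k)`. Such a `k` automatically satisfies `-m₀ < k ≤ n₀`: otherwise
`A ≤ β` or `B ≤ α`, and `A * B > 1` would give `1 - 2α > 1` or `1 - 2β > 1`.

*Covering* (`FullAt.of_mem_range`). Conversely, given such a `k`, consider `C_α + γ ^ i C_β` for
`1 - k - m₀ ≤ i ≤ n₀ - k`. For these `i` the hull is covered both by the two hulls obtained by
subdividing `C_α` once (which turns `i` into `i + n₀`) and by those obtained by subdividing `C_β`
(which turns `i` into `i - m₀`), and one of the two choices keeps `i` in the range. Iterating from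
`i = 0`, all the finite steps have full sum, and `C_α + C_β = [0, 2]` follows by compactness.
-/

/-! ### The self-similar structure of the middle Cantor set -/

section SelfSimilar

variable {α : ℝ}

theorem preMiddleCantor_subset_Icc (h0 : 0 < α) (h1 : α < 1 / 2) (n : ℕ) :
    preMiddleCantor α n ⊆ Set.Icc 0 1 := by
  induction n with
  | zero => exact subset_rfl
  | succ n ih =>
    rintro _ (⟨x, hx, rfl⟩ | ⟨x, hx, rfl⟩) <;> obtain ⟨h2, h3⟩ := ih hx <;>
      constructor <;> dsimp only <;> nlinarith

theorem preMiddleCantor_succ_subset (h0 : 0 < α) (h1 : α < 1 / 2) (n : ℕ) :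
    preMiddleCantor α (n + 1) ⊆ preMiddleCantor α n := by
  induction n with
  | zero => exact preMiddleCantor_subset_Icc h0 h1 1
  | succ n ih => exact Set.union_subset_union (Set.image_mono ih) (Set.image_mono ih)

theorem isCompact_preMiddleCantor (α : ℝ) (n : ℕ) : IsCompact (preMiddleCantor α n) := by
  induction n with
  | zero => exact isCompact_Icc
  | succ n ih => exact (ih.image (by fun_prop)).union (ih.image (by fun_prop))

theorem middleCantor_subset_Icc : middleCantor α ⊆ Set.Icc 0 1 :=
  Set.iInter_subset _ 0

theorem middleCantor_branch_mem (h0 : 0 < α) (h1 : α < 1 / 2) {t x : ℝ} (ht : t = 0 ∨ t = 1 - α)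
    (hx : x ∈ middleCantor α) : t + α * x ∈ middleCantor α := by
  refine Set.mem_iInter.2 fun n => preMiddleCantor_succ_subset h0 h1 n ?_
  have hxn := Set.mem_iInter.1 hx n
  rcases ht with rfl | rfl
  · exact Or.inl ⟨x, hxn, by simp⟩
  · exact Or.inr ⟨x, hxn, rfl⟩

theorem middleCantor_branch_inv_mem (h0 : 0 < α) (h1 : α < 1 / 2) {t y : ℝ}
    (ht : t = 0 ∨ t = 1 - α) (hy : y ∈ middleCantor α) (hty : t ≤ y) (hyt : y ≤ t + α) :
    (y - t) / α ∈ middleCantor α := by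
  refine Set.mem_iInter.2 fun n => ?_
  rcases Set.mem_iInter.1 hy (n + 1) with ⟨x, hx, rfl⟩ | ⟨x, hx, rfl⟩ <;>
    obtain ⟨hx0, hx1⟩ := preMiddleCantor_subset_Icc h0 h1 n hx <;> dsimp only at hty hyt ⊢ <;>
    rcases ht with rfl | rfl
  · convert hx using 1
    field_simp
    ring
  · nlinarith
  · nlinarith
  · convert hx using 1
    field_simp
    ring

theorem middleCantor_le_or_ge (h0 : 0 < α) {y : ℝ} (hy : y ∈ middleCantor α) :
    y ≤ α ∨ 1 - α ≤ y := by
  rcases Set.mem_iInter.1 hy 1 with ⟨x, ⟨hx0, hx1⟩, rfl⟩ | ⟨x, ⟨hx0, hx1⟩, rfl⟩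
  · left; dsimp only; nlinarith
  · right; dsimp only; nlinarith

theorem zero_mem_middleCantor (α : ℝ) : (0 : ℝ) ∈ middleCantor α := by
  refine Set.mem_iInter.2 fun n => ?_
  induction n with
  | zero => exact ⟨le_rfl, zero_le_one⟩
  | succ n ih => exact Or.inl ⟨0, ih, by simp⟩

theorem one_mem_middleCantor (α : ℝ) : (1 : ℝ) ∈ middleCantor α := by
  refine Set.mem_iInter.2 fun n => ?_
  induction n with
  | zero => exact ⟨zero_le_one, le_rfl⟩
  | succ n ih => exact Or.inr ⟨1, ih, by simp⟩

/-- The scaled central gap `(α ^ (n + 1), α ^ n (1 - α))` is a gap of the Cantor set. -/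
theorem middleCantor_le_pow_succ (h0 : 0 < α) (h1 : α < 1 / 2) (n : ℕ) {x : ℝ}
    (hx : x ∈ middleCantor α) (hxn : x < α ^ n * (1 - α)) : x ≤ α ^ (n + 1) := by
  induction n generalizing x with
  | zero =>
    rcases middleCantor_le_or_ge h0 hx with h | h
    · simpa using h
    · simp at hxn; linarith
  | succ n ih =>
    have hpow : α ^ n ≤ 1 := pow_le_one₀ h0.le (by linarith)
    have hpos : 0 < α ^ n := pow_pos h0 n
    have hlt : x < α * (α ^ n * (1 - α)) := by rw [pow_succ] at hxn; linarith
    have hxα : x ≤ 0 + α := by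
      have : α ^ n * (1 - α) ≤ 1 := mul_le_one₀ hpow (by linarith) (by linarith)
      nlinarith
    have hmem := middleCantor_branch_inv_mem h0 h1 (Or.inl rfl) hx
      (middleCantor_subset_Icc hx).1 hxα
    have := ih hmem (by rw [sub_zero, div_lt_iff₀ h0]; linarith)
    rw [sub_zero, div_le_iff₀ h0] at this
    rwa [pow_succ]

end SelfSimilar

/-! ### Gaps and a lower bound for the thickness -/

section Thickness

variable {α : ℝ}

theorem IsBoundedGap.branch_inv (h0 : 0 < α) (h1 : α < 1 / 2) {t u v : ℝ}
    (ht : t = 0 ∨ t = 1 - α) (h : IsBoundedGap (middleCantor α) u v) (hu : t ≤ u)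
    (hv : v ≤ t + α) : IsBoundedGap (middleCantor α) ((u - t) / α) ((v - t) / α) := by
  obtain ⟨huv, huC, hvC, hdisj⟩ := h
  refine ⟨by gcongr, middleCantor_branch_inv_mem h0 h1 ht huC hu (by linarith),
    middleCantor_branch_inv_mem h0 h1 ht hvC (by linarith) hv, ?_⟩
  rw [Set.disjoint_left] at hdisj ⊢
  rintro x ⟨hx1, hx2⟩ hx
  rw [div_lt_iff₀ h0] at hx1
  rw [lt_div_iff₀ h0] at hx2
  exact hdisj ⟨by linarith, by linarith⟩ (middleCantor_branch_mem h0 h1 ht hx)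

/-- Every bounded gap of `C_α` is obtained from the central gap `(α, 1 - α)` by finitely many
applications of the two branches. -/
theorem IsBoundedGap.induction (h0 : 0 < α) (h1 : α < 1 / 2) {P : ℝ → ℝ → Prop}
    (mid : P α (1 - α))
    (step : ∀ t a b, (t = 0 ∨ t = 1 - α) → P a b → P (t + α * a) (t + α * b))
    {a b : ℝ} (hab : IsBoundedGap (middleCantor α) a b) : P a b := by
  -- Undoing a branch stretches the gap by `1 / α`, and gaps have length at most `1`.
  obtain ⟨n, hn⟩ := exists_pow_lt_of_lt_one (sub_pos.2 hab.1) (by linarith : α < 1)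
  induction n generalizing a b with
  | zero =>
    have := (middleCantor_subset_Icc hab.2.1).1
    have := (middleCantor_subset_Icc hab.2.2.1).2
    rw [pow_zero] at hn
    linarith
  | succ n ih =>
    have same : ∀ t, (t = 0 ∨ t = 1 - α) → t ≤ a → b ≤ t + α → P a b := fun t ht hta hbt => by
      have := step t _ _ ht (ih (hab.branch_inv h0 h1 ht hta hbt) (by
        rw [← sub_div, lt_div_iff₀ h0, ← pow_succ]
        linarith))
      rwa [mul_div_cancel₀ _ h0.ne', mul_div_cancel₀ _ h0.ne', add_sub_cancel,
        add_sub_cancel] at this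
    obtain ⟨hlt, haC, hbC, hdisj⟩ := hab
    have ha0 := (middleCantor_subset_Icc haC).1
    have hb1 := (middleCantor_subset_Icc hbC).2
    rcases middleCantor_le_or_ge h0 haC with ha | ha
    · rcases middleCantor_le_or_ge h0 hbC with hb | hb
      · exact same 0 (Or.inl rfl) ha0 (by linarith)
      · have hα : α ∈ middleCantor α := by
          simpa using middleCantor_branch_mem h0 h1 (Or.inl rfl) (one_mem_middleCantor α)
        have hα' : 1 - α ∈ middleCantor α := by
          simpa using middleCantor_branch_mem h0 h1 (Or.inr rfl) (zero_mem_middleCantor α)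
        rw [Set.disjoint_left] at hdisj
        have hae : a = α := by
          by_contra hne
          exact hdisj ⟨lt_of_le_of_ne ha hne, by linarith⟩ hα
        have hbe : b = 1 - α := by
          by_contra hne
          exact hdisj ⟨by linarith, lt_of_le_of_ne hb (Ne.symm hne)⟩ hα'
        rwa [hae, hbe]
    · exact same (1 - α) (Or.inr rfl) ha (by linarith)

theorem IsBoundedGap.length_le (h0 : 0 < α) (h1 : α < 1 / 2) {a b : ℝ}
    (hab : IsBoundedGap (middleCantor α) a b) : b - a ≤ 1 - 2 * α := by
  refine hab.induction (P := fun a b => b - a ≤ 1 - 2 * α) h0 h1 (by linarith) fun t a b _ h => ?_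
  nlinarith

theorem AvoidsGaps.branch (h0 : 0 < α) (h1 : α < 1 / 2) {t ℓ c d : ℝ} (ht : t = 0 ∨ t = 1 - α)
    (h : AvoidsGaps (middleCantor α) ℓ c d) :
    AvoidsGaps (middleCantor α) (α * ℓ) (t + α * c) (t + α * d) := by
  obtain ⟨hcd, hc, hd, hgap⟩ := h
  have hc0 := (middleCantor_subset_Icc hc).1
  have hd1 := (middleCantor_subset_Icc hd).2
  refine ⟨by gcongr, middleCantor_branch_mem h0 h1 ht hc, middleCantor_branch_mem h0 h1 ht hd,
    fun u v huv hu hv => ?_⟩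
  have := hgap _ _ (huv.branch_inv h0 h1 ht (by nlinarith) (by nlinarith))
    (by rw [le_div_iff₀ h0]; linarith) (by rw [div_le_iff₀ h0]; linarith)
  rw [← sub_div, div_lt_iff₀ h0] at this
  linarith

/-- The two hulls `[0, α]` and `[1 - α, 1]` of the first step only contain gaps shorter than
the central one. -/
theorem avoidsGaps_first_step (h0 : 0 < α) (h1 : α < 1 / 2) {t : ℝ} (ht : t = 0 ∨ t = 1 - α) :
    AvoidsGaps (middleCantor α) (1 - 2 * α) t (t + α) := by
  have h : AvoidsGaps (middleCantor α) ((1 - 2 * α) / α) 0 1 :=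
    ⟨zero_le_one, zero_mem_middleCantor α, one_mem_middleCantor α, fun a b hab _ _ => by
      refine (hab.length_le h0 h1).trans_lt ?_
      rw [lt_div_iff₀ h0]
      nlinarith⟩
  have h' := h.branch h0 h1 ht
  rwa [mul_div_cancel₀ _ h0.ne', mul_zero, mul_one, add_zero] at h'

/-- Both bridges of a gap contain intervals whose ratio to the gap is that of the central gap. -/
theorem IsBoundedGap.exists_bridges (h0 : 0 < α) (h1 : α < 1 / 2) {a b : ℝ}
    (hab : IsBoundedGap (middleCantor α) a b) :
    (∃ c, AvoidsGaps (middleCantor α) (b - a) c a ∧ a - c = α / (1 - 2 * α) * (b - a)) ∧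
      ∃ d, AvoidsGaps (middleCantor α) (b - a) b d ∧ d - b = α / (1 - 2 * α) * (b - a) := by
  have hne : 1 - 2 * α ≠ 0 := by linarith
  refine hab.induction (P := fun a b =>
    (∃ c, AvoidsGaps (middleCantor α) (b - a) c a ∧ a - c = α / (1 - 2 * α) * (b - a)) ∧
      ∃ d, AvoidsGaps (middleCantor α) (b - a) b d ∧ d - b = α / (1 - 2 * α) * (b - a))
    h0 h1 ?_ ?_
  · have hlen : 1 - α - α = 1 - 2 * α := by ring
    rw [hlen, div_mul_cancel₀ _ hne]
    refine ⟨⟨0, ?_, by ring⟩, 1, ?_, by ring⟩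
    · simpa using avoidsGaps_first_step h0 h1 (Or.inl rfl)
    · simpa using avoidsGaps_first_step h0 h1 (Or.inr rfl)
  · rintro t a b ht ⟨⟨c, hc, hca⟩, d, hd, hdb⟩
    have hlen : t + α * b - (t + α * a) = α * (b - a) := by ring
    rw [hlen]
    refine ⟨⟨t + α * c, hc.branch h0 h1 ht, ?_⟩, t + α * d, hd.branch h0 h1 ht, ?_⟩
    · linear_combination α * hca
    · linear_combination α * hdb

theorem le_thickness_middleCantor (h0 : 0 < α) (h1 : α < 1 / 2) :
    ENNReal.ofReal (α / (1 - 2 * α)) ≤ thickness (middleCantor α) := by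
  have hpos : 0 < 1 - 2 * α := by linarith
  refine le_iInf fun a => le_iInf fun b => le_iInf fun hab => ?_
  obtain ⟨⟨c, hc, hca⟩, d, hd, hdb⟩ := hab.exists_bridges h0 h1
  have hlen : 0 < b - a := sub_pos.2 hab.1
  rw [ENNReal.le_div_iff_mul_le (Or.inl (by simpa using hlen)) (Or.inl ENNReal.ofReal_ne_top),
    ← ENNReal.ofReal_mul (by positivity)]
  refine le_min ?_ ?_
  · rw [← hca]
    exact le_iSup₂ (f := fun c (_ : AvoidsGaps (middleCantor α) (b - a) c a) =>
      ENNReal.ofReal (a - c)) c hc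
  · rw [← hdb]
    exact le_iSup₂ (f := fun d (_ : AvoidsGaps (middleCantor α) (b - a) b d) =>
      ENNReal.ofReal (d - b)) d hd

theorem ratio_of_thickness_mul_lt_one {α β : ℝ} (hα : 0 < α) (hα' : α < 1 / 2) (hβ : 0 < β)
    (hβ' : β < 1 / 2) (hτ : thickness (middleCantor α) * thickness (middleCantor β) < 1) :
    α * β < (1 - 2 * α) * (1 - 2 * β) := by
  have ha : 0 < 1 - 2 * α := by linarith
  have hb : 0 < 1 - 2 * β := by linarith
  have h := (mul_le_mul' (le_thickness_middleCantor hα hα')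
    (le_thickness_middleCantor hβ hβ')).trans_lt hτ
  rwa [← ENNReal.ofReal_mul (by positivity), ENNReal.ofReal_lt_one, div_mul_div_comm,
    div_lt_one (by positivity)] at h

end Thickness

/-! ### Gaps in the sum near the origin -/

/-- If `s = β ^ m / α ^ n` satisfies `α β / (1 - 2β) < s < 1 - 2α`, then the points just to the
right of `α ^ (n + 1) + β ^ m` are not in `C_α + C_β`. -/
theorem sum_ne_of_ratio_mem {α β : ℝ} (hα : 0 < α) (hα' : α < 1 / 2) (hβ : 0 < β)
    (hβ' : β < 1 / 2) (n m : ℕ) (h1 : α * β < β ^ m / α ^ n * (1 - 2 * β))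
    (h2 : β ^ m / α ^ n < 1 - 2 * α) :
    middleCantor α + middleCantor β ≠ Set.Icc 0 2 := by
  intro hfull
  have hn : 0 < α ^ n := pow_pos hα n
  have hn1 : α ^ n ≤ 1 := pow_le_one₀ hα.le (by linarith)
  have hm : 0 < β ^ m := pow_pos hβ m
  rw [div_mul_eq_mul_div, lt_div_iff₀ hn] at h1
  rw [div_lt_iff₀ hn] at h2
  -- The upper end `β ^ m (1 - β) / β` is where the next larger piece of `C_β` begins.
  have hlt : α ^ (n + 1) + β ^ m < min (α ^ n * (1 - α)) (β ^ m * (1 - β) / β) := by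
    rw [lt_min_iff, lt_div_iff₀ hβ, pow_succ]
    constructor <;> nlinarith
  obtain ⟨x, hx1, hx2⟩ := exists_between hlt
  obtain ⟨hxa, hxb⟩ := lt_min_iff.1 hx2
  have hx : x ∈ middleCantor α + middleCantor β := by
    rw [hfull]
    have := pow_pos hα (n + 1)
    constructor <;> nlinarith
  obtain ⟨a, ha, b, hb, rfl⟩ := Set.mem_add.1 hx
  have ha0 := (middleCantor_subset_Icc ha).1
  obtain ⟨hb0, hb1⟩ := middleCantor_subset_Icc hb
  have hale := middleCantor_le_pow_succ hα hα' n ha (by linarith)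
  have hble : b ≤ β ^ m := by
    cases m with
    | zero => simpa using hb1
    | succ m =>
      refine middleCantor_le_pow_succ hβ hβ' m hb ?_
      have : β ^ (m + 1) * (1 - β) / β = β ^ m * (1 - β) := by
        field_simp
        ring
      linarith
  linarith

/-- For `a / b` irrational the differences `n a - m b` with natural numbers `n`, `m` are dense. -/
theorem exists_nat_mul_sub_mem_Ioo {a b : ℝ} (ha : 0 < a) (hb : 0 < b) (h : Irrational (a / b))
    {u v : ℝ} (huv : u < v) : ∃ n m : ℕ, (n * a - m * b : ℝ) ∈ Set.Ioo u v := by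
  -- If an integer combination `n a + m b` lies in `(0, min a b)`, then `n` and `m` have opposite
  -- signs, so that it is a difference of natural multiples up to sign.
  have hd : 0 < min (v - u) (min a b) := lt_min (sub_pos.2 huv) (lt_min ha hb)
  obtain ⟨g, hg, hg0, hgd⟩ := (dense_addSubgroupClosure_pair_iff.2 h).exists_between hd
  obtain ⟨hguv, hgab⟩ := lt_min_iff.1 hgd
  obtain ⟨hga, hgb⟩ := lt_min_iff.1 hgab
  obtain ⟨n, m, rfl⟩ := AddSubgroup.mem_closure_pair.1 hg
  simp only [zsmul_eq_mul] at hg0 hguv hga hgb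
  rcases le_or_gt 0 n with hn | hn
  · rcases le_or_gt m 0 with hm | hm
    · -- Start below `u` with a multiple of `-b` and climb by steps of `g`.
      obtain ⟨n, rfl⟩ := Int.eq_ofNat_of_zero_le hn
      obtain ⟨m, rfl⟩ := Int.exists_eq_neg_ofNat hm
      push_cast at *
      obtain ⟨M, hM⟩ := exists_nat_ge (-u / b)
      rw [div_le_iff₀ hb] at hM
      have h0 : 0 ≤ (u + M * b) / (n * a + -m * b) := div_nonneg (by linarith) hg0.le
      have h1 := Nat.floor_le h0
      have h2 := Nat.lt_floor_add_one ((u + M * b) / (n * a + -m * b))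
      rw [le_div_iff₀ hg0] at h1
      rw [div_lt_iff₀ hg0] at h2
      set K := ⌊(u + M * b) / (n * a + -m * b)⌋₊
      refine ⟨(K + 1) * n, (K + 1) * m + M, ?_, ?_⟩ <;> push_cast <;> linarith
    · have hm1 : (1 : ℝ) ≤ m := by exact_mod_cast hm
      have hn0 : (0 : ℝ) ≤ n := by exact_mod_cast hn
      nlinarith
  · rcases le_or_gt m 0 with hm | hm
    · have hn0 : (n : ℝ) < 0 := by exact_mod_cast hn
      have hm0 : (m : ℝ) ≤ 0 := by exact_mod_cast hm
      nlinarith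
    · -- Start above `v` with a multiple of `a` and descend by steps of `g`.
      obtain ⟨n, rfl⟩ := Int.exists_eq_neg_ofNat hn.le
      obtain ⟨m, rfl⟩ := Int.eq_ofNat_of_zero_le hm.le
      push_cast at *
      obtain ⟨N, hN⟩ := exists_nat_ge (v / a)
      rw [div_le_iff₀ ha] at hN
      have h0 : 0 ≤ (N * a - v) / (-n * a + m * b) := div_nonneg (by linarith) hg0.le
      have h1 := Nat.floor_le h0
      have h2 := Nat.lt_floor_add_one ((N * a - v) / (-n * a + m * b))
      rw [le_div_iff₀ hg0] at h1
      rw [div_lt_iff₀ hg0] at h2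
      set K := ⌊(N * a - v) / (-n * a + m * b)⌋₊
      refine ⟨(K + 1) * n + N, (K + 1) * m, ?_, ?_⟩ <;> push_cast <;> linarith

theorem sum_ne_of_irrational {α β : ℝ} (hα : 0 < α) (hα' : α < 1 / 2) (hβ : 0 < β)
    (hβ' : β < 1 / 2) (hr : α * β < (1 - 2 * α) * (1 - 2 * β))
    (h : Irrational (Real.log α / Real.log β)) :
    middleCantor α + middleCantor β ≠ Set.Icc 0 2 := by
  have ha : 0 < 1 - 2 * α := by linarith
  have hb : 0 < 1 - 2 * β := by linarith
  have hlt : α * β / (1 - 2 * β) < 1 - 2 * α := by rwa [div_lt_iff₀ hb]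
  have hpos : 0 < α * β / (1 - 2 * β) := by positivity
  obtain ⟨n, m, h1, h2⟩ := exists_nat_mul_sub_mem_Ioo
    (neg_pos.2 (Real.log_neg hα (by linarith))) (neg_pos.2 (Real.log_neg hβ (by linarith)))
    (by rwa [neg_div_neg_eq]) (Real.log_lt_log hpos hlt)
  have hq : 0 < β ^ m / α ^ n := by positivity
  have hlog : Real.log (β ^ m / α ^ n) = n * -Real.log α - m * -Real.log β := by
    rw [Real.log_div (by positivity) (by positivity), Real.log_pow, Real.log_pow]
    ring
  rw [← hlog] at h1 h2
  refine sum_ne_of_ratio_mem hα hα' hβ hβ' n m ?_ ((Real.log_lt_log_iff hq ha).1 h2)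
  exact (div_lt_iff₀ hb).1 ((Real.log_lt_log_iff hpos hq).1 h1)

/-! ### Covering by subdivision -/

/-- The sum of the `p`-th step for `α` and `s` times the `q`-th step for `β` contains the whole
hull `[0, 1 + s]`. -/
def FullAt (α β : ℝ) (p q : ℕ) (s : ℝ) : Prop :=
  ∀ x ∈ Set.Icc 0 (1 + s), ∃ a ∈ preMiddleCantor α p, ∃ b ∈ preMiddleCantor β q, a + s * b = x

section Covering

variable {α β : ℝ} {p q : ℕ} {s : ℝ}

theorem FullAt.subdivide_left (hα : 0 < α) (hs : 1 - 2 * α ≤ s) (h : FullAt α β p q (s / α)) :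
    FullAt α β (p + 1) q s := by
  rintro x ⟨hx0, hx1⟩
  have key : ∀ t, t ≤ x → x ≤ t + α + s → ∃ a ∈ preMiddleCantor α p,
      ∃ b ∈ preMiddleCantor β q, t + α * a + s * b = x := fun t ht hx => by
    obtain ⟨a, ha, b, hb, hab⟩ := h ((x - t) / α)
      ⟨div_nonneg (by linarith) hα.le, by rw [div_le_iff₀ hα]; field_simp; linarith⟩
    refine ⟨a, ha, b, hb, ?_⟩
    field_simp at hab
    linarith
  rcases le_total x (α + s) with hx | hx
  · obtain ⟨a, ha, b, hb, hab⟩ := key 0 hx0 (by linarith)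
    exact ⟨α * a, Or.inl ⟨a, ha, rfl⟩, b, hb, by linarith⟩
  · obtain ⟨a, ha, b, hb, hab⟩ := key (1 - α) (by linarith) (by linarith)
    exact ⟨1 - α + α * a, Or.inr ⟨a, ha, rfl⟩, b, hb, hab⟩

theorem FullAt.subdivide_right (hs : s * (1 - 2 * β) ≤ 1) (h : FullAt α β p q (s * β)) :
    FullAt α β p (q + 1) s := by
  rintro x ⟨hx0, hx1⟩
  rcases le_total x (1 + s * β) with hx | hx
  · obtain ⟨a, ha, b, hb, hab⟩ := h x ⟨hx0, hx⟩
    exact ⟨a, ha, β * b, Or.inl ⟨b, hb, rfl⟩, by linarith⟩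
  · obtain ⟨a, ha, b, hb, hab⟩ := h (x - s * (1 - β)) ⟨by linarith, by linarith⟩
    exact ⟨a, ha, 1 - β + β * b, Or.inr ⟨b, hb, rfl⟩, by linarith⟩

theorem fullAt_zero_zero (hs : 0 ≤ s) : FullAt α β 0 0 s := by
  rintro x ⟨hx0, hx1⟩
  rcases le_total x 1 with hx | hx
  · exact ⟨x, ⟨hx0, hx⟩, 0, ⟨le_rfl, zero_le_one⟩, by simp⟩
  · have hs' : 0 < s ∨ s = 0 := hs.lt_or_eq.imp_right Eq.symm
    rcases hs' with hs' | rfl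
    · exact ⟨1, ⟨zero_le_one, le_rfl⟩, (x - 1) / s,
        ⟨div_nonneg (by linarith) hs, by rw [div_le_one hs']; linarith⟩, by field_simp; ring⟩
    · exact ⟨1, ⟨zero_le_one, le_rfl⟩, 0, ⟨le_rfl, zero_le_one⟩, by linarith⟩

theorem fullAt_zero_left (hβ : 0 < β) (hβ' : β < 1 / 2) (q : ℕ) (hs : 0 ≤ s)
    (hs' : s * (1 - 2 * β) ≤ 1) : FullAt α β 0 q s := by
  induction q generalizing s with
  | zero => exact fullAt_zero_zero hs
  | succ q ih =>
    refine (ih (by positivity) ?_).subdivide_right hs'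
    nlinarith [mul_nonneg hs (by linarith : 0 ≤ 1 - 2 * β)]

theorem fullAt_zero_right (hα : 0 < α) (hα' : α < 1 / 2) (p : ℕ) (hs : 1 - 2 * α ≤ s) :
    FullAt α β p 0 s := by
  induction p generalizing s with
  | zero => exact fullAt_zero_zero (by linarith)
  | succ p ih =>
    refine (ih (hs.trans ?_)).subdivide_left hα hs
    rw [le_div_iff₀ hα]
    nlinarith

/-- The exponents `1 - k - m₀ ≤ i ≤ n₀ - k` are closed under a suitable choice of the
subdivision, and for all of them both subdivisions cover the hull. -/
theorem FullAt.of_mem_range (hα : 0 < α) (hα' : α < 1 / 2) (hβ : 0 < β) (hβ' : β < 1 / 2)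
    {γ : ℝ} (hγ : 1 < γ) {m₀ n₀ : ℕ} (hαγ : α = γ ^ (-(n₀ : ℤ))) (hβγ : β = γ ^ (-(m₀ : ℤ)))
    {k : ℤ} (hA : 1 - 2 * β ≤ α * γ ^ k) (hB : 1 - 2 * α ≤ β * γ ^ (1 - k)) (p q : ℕ) (i : ℤ)
    (hi : 1 - k - m₀ ≤ i) (hi' : i ≤ n₀ - k) : FullAt α β p q (γ ^ i) := by
  have hγ0 : γ ≠ 0 := by positivity
  have hleft : ∀ i : ℤ, 1 - k - m₀ ≤ i → 1 - 2 * α ≤ γ ^ i := fun i hi => by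
    refine hB.trans ?_
    rw [hβγ, ← zpow_add₀ hγ0]
    exact zpow_le_zpow_right₀ hγ.le (by linarith)
  have hright : ∀ i : ℤ, i ≤ n₀ - k → γ ^ i * (1 - 2 * β) ≤ 1 := fun i hi => by
    refine (mul_le_mul_of_nonneg_left hA (by positivity)).trans ?_
    rw [hαγ, ← zpow_add₀ hγ0, ← zpow_add₀ hγ0]
    exact zpow_le_one_of_nonpos₀ hγ.le (by linarith)
  induction hN : p + q generalizing p q i with
  | zero =>
    obtain ⟨rfl, rfl⟩ : p = 0 ∧ q = 0 := by omega
    exact fullAt_zero_zero (by positivity)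
  | succ N ih =>
    rcases p with - | p
    · exact fullAt_zero_left hβ hβ' q (by positivity) (hright i hi')
    rcases q with - | q
    · exact fullAt_zero_right hα hα' (p + 1) (hleft i hi)
    rcases le_or_gt i (-k) with hik | hik
    · refine FullAt.subdivide_left hα (hleft i hi) ?_
      have := ih p (q + 1) (i + n₀) (by omega) (by omega) (by omega)
      rwa [zpow_add₀ hγ0, ← inv_inv (γ ^ (n₀ : ℤ)), ← zpow_neg, ← hαγ, ← div_eq_mul_inv] at this
    · refine FullAt.subdivide_right (hright i hi') ?_
      have := ih (p + 1) q (i - m₀) (by omega) (by omega) (by omega)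
      rwa [sub_eq_add_neg, zpow_add₀ hγ0, ← hβγ] at this

theorem sum_eq_of_fullAt (hα : 0 < α) (hα' : α < 1 / 2) (hβ : 0 < β) (hβ' : β < 1 / 2)
    (h : ∀ n, FullAt α β n n 1) : middleCantor α + middleCantor β = Set.Icc 0 2 := by
  apply Set.Subset.antisymm
  · rintro _ ⟨a, ha, b, hb, rfl⟩
    obtain ⟨ha0, ha1⟩ := middleCantor_subset_Icc ha
    obtain ⟨hb0, hb1⟩ := middleCantor_subset_Icc hb
    constructor <;> dsimp only <;> linarith
  · intro x hx
    obtain ⟨a, ha⟩ := IsCompact.nonempty_iInter_of_sequence_nonempty_isCompact_isClosed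
      (fun n => preMiddleCantor α n ∩ (fun y => x - y) ⁻¹' preMiddleCantor β n)
      (fun n => Set.inter_subset_inter (preMiddleCantor_succ_subset hα hα' n)
        (Set.preimage_mono (preMiddleCantor_succ_subset hβ hβ' n)))
      (fun n => by
        obtain ⟨a, ha, b, hb, hab⟩ := h n x (by norm_num; exact hx)
        refine ⟨a, ha, ?_⟩
        have hb' : x - a = b := by linarith
        simpa only [Set.mem_preimage, hb'] using hb)
      ((isCompact_preMiddleCantor α 0).inter_right
        ((isCompact_preMiddleCantor β 0).isClosed.preimage (by fun_prop)))
      (fun n => (isCompact_preMiddleCantor α n).isClosed.inter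
        ((isCompact_preMiddleCantor β n).isClosed.preimage (by fun_prop)))
    rw [Set.mem_iInter] at ha
    exact Set.mem_add.2 ⟨a, Set.mem_iInter.2 fun n => (ha n).1, x - a,
      Set.mem_iInter.2 fun n => (ha n).2, by ring⟩

end Covering

/-! ### Commensurable ratios -/

section Commensurable

variable {α β γ : ℝ} {m₀ n₀ : ℕ}

theorem exists_base_of_not_irrational (hα : 0 < α) (hα' : α < 1) (hβ : 0 < β) (hβ' : β < 1)
    (h : ¬ Irrational (Real.log α / Real.log β)) :
    ∃ (m₀ n₀ : ℕ) (γ : ℝ), 0 < m₀ ∧ 0 < n₀ ∧ Nat.Coprime m₀ n₀ ∧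
      α = γ ^ (-(n₀ : ℤ)) ∧ β = γ ^ (-(m₀ : ℤ)) := by
  have hla := Real.log_neg hα hα'
  have hlb := Real.log_neg hβ hβ'
  obtain ⟨r, hr⟩ := not_not.1 h
  have hr0 : 0 < r := by
    have : (0 : ℝ) < r := hr ▸ div_pos_of_neg_of_neg hla hlb
    exact_mod_cast this
  have hnum : 0 < r.num := Rat.num_pos.2 hr0
  have hn : (r.num.natAbs : ℝ) = r.num := by
    rw [Nat.cast_natAbs, abs_of_pos hnum]
  have hn0 : (0 : ℝ) < r.num := by exact_mod_cast hnum
  have hm0 : (0 : ℝ) < r.den := by exact_mod_cast r.pos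
  have hlog : Real.log α * r.den = r.num * Real.log β := by
    have : (r : ℝ) = r.num / r.den := by exact_mod_cast (Rat.num_div_den r).symm
    rw [this, div_eq_div_iff hm0.ne' hlb.ne] at hr
    exact hr.symm
  refine ⟨r.den, r.num.natAbs, Real.exp (-Real.log α / r.num), r.pos,
    Int.natAbs_pos.2 hnum.ne', r.reduced.symm, ?_, ?_⟩
  · rw [zpow_neg, zpow_natCast, ← Real.exp_nat_mul, ← Real.exp_neg, hn]
    nth_rewrite 1 [← Real.exp_log hα]
    congr 1
    field_simp
  · rw [zpow_neg, zpow_natCast, ← Real.exp_nat_mul, ← Real.exp_neg]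
    nth_rewrite 1 [← Real.exp_log hβ]
    congr 1
    field_simp
    linarith

/-- The base is positive because a negative one would need both exponents to be even. -/
theorem one_lt_base (hα : 0 < α) (hα' : α < 1) (hβ : 0 < β) (hcop : Nat.Coprime m₀ n₀)
    (hαγ : α = γ ^ (-(n₀ : ℤ))) (hβγ : β = γ ^ (-(m₀ : ℤ))) : 1 < γ := by
  rw [zpow_neg, zpow_natCast] at hαγ hβγ
  have hn : 0 < γ ^ n₀ := by rwa [hαγ, inv_pos] at hα
  have hm : 0 < γ ^ m₀ := by rwa [hβγ, inv_pos] at hβ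
  have hn1 : 1 < γ ^ n₀ := by rwa [hαγ, inv_lt_one₀ hn] at hα'
  by_contra! hγ
  rcases le_or_gt 0 γ with h0 | h0
  · exact hn1.not_ge (pow_le_one₀ h0 hγ)
  · have hne : Even n₀ := by
      by_contra hodd
      exact hn.not_gt ((Nat.not_even_iff_odd.1 hodd).pow_neg h0)
    have hme : Even m₀ := by
      by_contra hodd
      exact hm.not_gt ((Nat.not_even_iff_odd.1 hodd).pow_neg h0)
    have := Nat.dvd_gcd hme.two_dvd hne.two_dvd
    rw [hcop.gcd_eq_one] at this
    omega

/-- Every power of `γ` is a ratio `β ^ m / α ^ n`. -/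
theorem exists_pow_div_pow_eq_zpow (hγ : 1 < γ) (hm : 0 < m₀) (hn : 0 < n₀)
    (hcop : Nat.Coprime m₀ n₀) (hαγ : α = γ ^ (-(n₀ : ℤ))) (hβγ : β = γ ^ (-(m₀ : ℤ))) (j : ℤ) :
    ∃ n m : ℕ, β ^ m / α ^ n = γ ^ j := by
  have hγ0 : γ ≠ 0 := by positivity
  have hbez := Nat.gcd_eq_gcd_ab n₀ m₀
  rw [hcop.symm.gcd_eq_one] at hbez
  set x := Nat.gcdA n₀ m₀
  set y := Nat.gcdB n₀ m₀
  -- Add a large multiple of `(m₀, n₀)` to a Bézout solution to make it nonnegative.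
  set M : ℤ := |j * x| + |j * y|
  have hM0 : 0 ≤ M := by positivity
  have hx : 0 ≤ j * x + M * m₀ := by
    nlinarith [neg_abs_le (j * x), abs_nonneg (j * y), (by exact_mod_cast hm : (1 : ℤ) ≤ m₀)]
  have hy : 0 ≤ -(j * y) + M * n₀ := by
    nlinarith [le_abs_self (j * y), abs_nonneg (j * x), (by exact_mod_cast hn : (1 : ℤ) ≤ n₀)]
  obtain ⟨n, hn'⟩ := Int.eq_ofNat_of_zero_le hx
  obtain ⟨m, hm'⟩ := Int.eq_ofNat_of_zero_le hy
  refine ⟨n, m, ?_⟩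
  rw [hαγ, hβγ, ← zpow_natCast, ← zpow_natCast, ← zpow_mul, ← zpow_mul, ← zpow_sub₀ hγ0, ← hn',
    ← hm']
  congr 1
  push_cast at hbez
  linear_combination (-j) * hbez

theorem sum_eq_iff_exists_zpow (hα : 0 < α) (hα' : α < 1 / 2) (hβ : 0 < β)
    (hβ' : β < 1 / 2) (hr : α * β < (1 - 2 * α) * (1 - 2 * β)) (hγ : 1 < γ) (hm : 0 < m₀)
    (hn : 0 < n₀) (hcop : Nat.Coprime m₀ n₀) (hαγ : α = γ ^ (-(n₀ : ℤ)))
    (hβγ : β = γ ^ (-(m₀ : ℤ))) :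
    middleCantor α + middleCantor β = Set.Icc 0 2 ↔
      ∃ k ∈ Set.Icc (-(m₀ : ℤ) + 1) (n₀ : ℤ),
        1 - 2 * β ≤ α * γ ^ k ∧ 1 - 2 * α ≤ β * γ ^ (1 - k) := by
  have hγ0 : γ ≠ 0 := by positivity
  have ha : 0 < 1 - 2 * α := by linarith
  have hb : 0 < 1 - 2 * β := by linarith
  constructor
  · intro hfull
    -- The least `k` satisfying the first inequality also satisfies the second one.
    obtain ⟨k, hk1, hk2⟩ := exists_mem_Ioc_zpow (div_pos hb hα) hγ
    rw [lt_div_iff₀ hα] at hk1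
    rw [div_le_iff₀' hα] at hk2
    have hB : 1 - 2 * α ≤ β * γ ^ (1 - (k + 1)) := by
      obtain ⟨n, m, hnm⟩ := exists_pow_div_pow_eq_zpow hγ hm hn hcop hαγ hβγ (-m₀ - k)
      have hj : γ ^ (-m₀ - k : ℤ) = β * γ ^ (1 - (k + 1)) := by
        rw [hβγ, ← zpow_add₀ hγ0]
        congr 1
        ring
      by_contra! hlt
      refine sum_ne_of_ratio_mem hα hα' hβ hβ' n m ?_ ?_ hfull
      · rw [hnm, hj]
        have hinv : γ ^ (1 - (k + 1)) * γ ^ k = 1 := by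
          rw [← zpow_add₀ hγ0]
          simp
        have hp : 0 < β * γ ^ (1 - (k + 1)) := by positivity
        calc α * β = β * γ ^ (1 - (k + 1)) * (γ ^ k * α) := by linear_combination (-α * β) * hinv
          _ < _ := by gcongr
      · rw [hnm, hj]
        exact hlt
    refine ⟨k + 1, ⟨?_, ?_⟩, hk2, hB⟩
    · by_contra! hlt
      -- Otherwise `γ ^ (k + 1) ≤ β`, so `1 - 2 * β ≤ α * β` and `1 < 1 - 2 * α`.
      have : γ ^ (k + 1) ≤ β := by
        rw [hβγ]
        exact zpow_le_zpow_right₀ hγ.le (by omega)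
      nlinarith
    · by_contra! hlt
      have : γ ^ (1 - (k + 1)) ≤ α := by
        rw [hαγ]
        exact zpow_le_zpow_right₀ hγ.le (by omega)
      nlinarith
  · rintro ⟨k, ⟨hk1, hk2⟩, hA, hB⟩
    refine sum_eq_of_fullAt hα hα' hβ hβ' fun n => ?_
    have := FullAt.of_mem_range hα hα' hβ hβ' hγ hαγ hβγ hA hB n n 0 (by omega) (by omega)
    rwa [zpow_zero] at this

end Commensurable

theorem mainTheorem12 (α β : ℝ) (hα : 0 < α) (hα' : α < 1 / 2) (hβ : 0 < β) (hβ' : β < 1 / 2)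
    (hτ : thickness (middleCantor α) * thickness (middleCantor β) < 1) :
    (Irrational (Real.log α / Real.log β) →
      middleCantor α + middleCantor β ≠ Set.Icc 0 2) ∧
    (¬ Irrational (Real.log α / Real.log β) →
      (∃ (m₀ n₀ : ℕ) (γ : ℝ), 0 < m₀ ∧ 0 < n₀ ∧ Nat.Coprime m₀ n₀ ∧
        α = γ ^ (-(n₀ : ℤ)) ∧ β = γ ^ (-(m₀ : ℤ))) ∧
      ∀ (m₀ n₀ : ℕ) (γ : ℝ), 0 < m₀ → 0 < n₀ → Nat.Coprime m₀ n₀ →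
        α = γ ^ (-(n₀ : ℤ)) → β = γ ^ (-(m₀ : ℤ)) →
        (middleCantor α + middleCantor β = Set.Icc 0 2 ↔
          (Set.Icc (Real.logb γ ((1 - 2 * β) / α)) (1 - Real.logb γ ((1 - 2 * α) / β)) ∩
            ((fun k : ℤ => (k : ℝ)) '' Set.Icc (-(m₀ : ℤ) + 1) (n₀ : ℤ))).Nonempty)) := by
  have hr := ratio_of_thickness_mul_lt_one hα hα' hβ hβ' hτ
  refine ⟨sum_ne_of_irrational hα hα' hβ hβ' hr, fun h =>
    ⟨exists_base_of_not_irrational hα (by linarith) hβ (by linarith) h, ?_⟩⟩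
  intro m₀ n₀ γ hm hn hcop hαγ hβγ
  have hγ := one_lt_base hα (by linarith) hβ hcop hαγ hβγ
  have hγ0 : 0 < γ := by linarith
  rw [sum_eq_iff_exists_zpow hα hα' hβ hβ' hr hγ hm hn hcop hαγ hβγ]
  have key : ∀ k : ℤ, (k : ℝ) ∈ Set.Icc (Real.logb γ ((1 - 2 * β) / α))
      (1 - Real.logb γ ((1 - 2 * α) / β)) ↔
      1 - 2 * β ≤ α * γ ^ k ∧ 1 - 2 * α ≤ β * γ ^ (1 - k) := fun k => by
    have hcast : (1 - k : ℝ) = ((1 - k : ℤ) : ℝ) := by push_cast; ring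
    rw [Set.mem_Icc, le_sub_comm, hcast,
      Real.logb_le_iff_le_rpow hγ (div_pos (by linarith) hα),
      Real.logb_le_iff_le_rpow hγ (div_pos (by linarith) hβ), Real.rpow_intCast,
      Real.rpow_intCast, div_le_iff₀' hα, div_le_iff₀' hβ]
  constructor
  · rintro ⟨k, hk, hAB⟩
    exact ⟨k, (key k).2 hAB, k, hk, rfl⟩
  · rintro ⟨_, hlog, k, hk, rfl⟩
    exact ⟨k, hk, (key k).1 hlog⟩
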